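/- Let $m\in\mathbb N$, let $M_m(\mathbb C)$ denote the complex $m\times m$ matrices, and let $M_m^{+}(\mathbb C)$ denote the set of positive semidefinite (Hermitian) ones. For $X\in M_m^{+}(\mathbb C)$ and $p>0$, let $X^p\in M_m^{+}(\mathbb C)$ denote the power defined by the functional calculus (with $0^p=0$). Then for all $B\in M_m(\mathbb C)$, $0<s<1$ and $0<r\le 1$, the map $$A\mapsto \operatorname{tr}\bigl[(B^*A^sB)^{r/s}\bigr]\in\mathbb R$$ is concave on $M_m^{+}(\mathbb C)$. -/

import Mathlib

open scoped ComplexOrder MatrixOrder Matrix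

/-!
If `r ≤ s`, then `x ↦ x ^ (r / s)` is operator concave and operator monotone, and
`A ↦ Bᴴ A ^ s B` is operator concave. If `s < r`, replacing `A` by `A ^ r` reduces the claim to
`r = 1`, because `A ↦ A ^ r` is operator concave and the functional is monotone.

For `r = 1` write `X = Bᴴ A ^ s B`. Young's inequality for traces gives
`s * tr (X ^ s⁻¹) = max_W (tr (X * W ^ (1 - s)) - (1 - s) * tr W)`, attained at `W = X ^ s⁻¹`, and
the right-hand side is the partial maximum of a jointly concave function of `(A, W)`, hence concave
in `A`. The joint concavity is Lieb's theorem: `x ^ s * y ^ (1 - s)` is an integral over `t > 0` of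
the parallel sums `x * y / (x + t * y)`, and the quadratic form of the corresponding parallel sum of
left multiplication by `A` and right multiplication by `W` is a minimum of energies linear in
`(A, W)`.
-/

open Matrix MeasureTheory Set

variable {m n : Type*} [Fintype m] [Fintype n]

section SpectralForm

variable [DecidableEq m] [DecidableEq n]

/-- The change of coordinates `K ↦ Uᴴ K V`, where the columns of `U` and `V` are eigenvectors of `A`
and `W`. It diagonalizes left multiplication by `A` and right multiplication by `W`
simultaneously. -/
noncomputable def toEigenbases {A : Matrix n n ℂ} {W : Matrix m m ℂ} (hA : A.IsHermitian)
    (hW : W.IsHermitian) : Matrix n m ℂ ≃ₗ[ℂ] Matrix n m ℂ where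
  toFun K := (hA.eigenvectorUnitary : Matrix n n ℂ)ᴴ * K * (hW.eigenvectorUnitary : Matrix m m ℂ)
  invFun K := (hA.eigenvectorUnitary : Matrix n n ℂ) * K * (hW.eigenvectorUnitary : Matrix m m ℂ)ᴴ
  map_add' K L := by rw [Matrix.mul_add, Matrix.add_mul]
  map_smul' c K := by rw [Matrix.mul_smul, Matrix.smul_mul, RingHom.id_apply]
  left_inv K := by
    have hU := mem_unitaryGroup_iff.1 hA.eigenvectorUnitary.2
    have hV := mem_unitaryGroup_iff.1 hW.eigenvectorUnitary.2
    rw [star_eq_conjTranspose] at hU hV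
    simp only [Matrix.mul_assoc, hV, Matrix.mul_one]
    rw [← Matrix.mul_assoc, hU, Matrix.one_mul]
  right_inv K := by
    have hU := mem_unitaryGroup_iff'.1 hA.eigenvectorUnitary.2
    have hV := mem_unitaryGroup_iff'.1 hW.eigenvectorUnitary.2
    rw [star_eq_conjTranspose] at hU hV
    simp only [Matrix.mul_assoc, hV, Matrix.mul_one]
    rw [← Matrix.mul_assoc, hU, Matrix.one_mul]

/-- The quadratic form `⟪K, F(L, R) K⟫` of the Hilbert–Schmidt inner product at `K`, where `L` is
left multiplication by `A`, `R` is right multiplication by `W`, and `F(L, R)` is given by the joint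
functional calculus of these two commuting operators. -/
noncomputable def spectralForm {A : Matrix n n ℂ} {W : Matrix m m ℂ} (hA : A.IsHermitian)
    (hW : W.IsHermitian) (F : ℝ → ℝ → ℝ) (K : Matrix n m ℂ) : ℝ :=
  ∑ i, ∑ j, F (hA.eigenvalues i) (hW.eigenvalues j) * Complex.normSq (toEigenbases hA hW K i j)

theorem re_trace_conjTranspose_mul_diagonal_mul (M : Matrix n m ℂ) (d : n → ℝ) (e : m → ℝ) :
    (trace (Mᴴ * diagonal (fun i => (d i : ℂ)) * M * diagonal (fun j => (e j : ℂ)))).re =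
      ∑ i, ∑ j, d i * e j * Complex.normSq (M i j) := by
  have hentry (i : n) (j : m) : star (M i j) * d i * M i j * e j =
      ((d i * e j * Complex.normSq (M i j) : ℝ) : ℂ) := by
    push_cast
    rw [Complex.normSq_eq_conj_mul_self, Complex.star_def]
    ring
  simp only [trace, Complex.re_sum, diag_apply]
  rw [Finset.sum_comm]
  refine Finset.sum_congr rfl fun j _ => ?_
  rw [mul_diagonal, mul_apply, Finset.sum_mul, Complex.re_sum]
  refine Finset.sum_congr rfl fun i _ => ?_
  rw [mul_diagonal, conjTranspose_apply, hentry, Complex.ofReal_re]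

variable {A : Matrix n n ℂ} {W : Matrix m m ℂ}

theorem spectralForm_mul_eq_re_trace_cfc (hA : A.IsHermitian) (hW : W.IsHermitian) (f g : ℝ → ℝ)
    (K : Matrix n m ℂ) :
    spectralForm hA hW (fun x y => f x * g y) K = (trace (Kᴴ * cfc f A * K * cfc g W)).re := by
  rw [spectralForm, ← re_trace_conjTranspose_mul_diagonal_mul, hA.cfc_eq, hW.cfc_eq]
  simp only [toEigenbases, LinearEquiv.coe_mk, LinearMap.coe_mk, AddHom.coe_mk, IsHermitian.cfc,
    Unitary.conjStarAlgAut_apply, star_eq_conjTranspose, conjTranspose_mul,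
    conjTranspose_conjTranspose, Matrix.mul_assoc]
  rw [trace_mul_comm]
  simp only [Matrix.mul_assoc]
  rfl

theorem spectralForm_rpow_mul_rpow (hA : 0 ≤ A) (hW : 0 ≤ W) (p q : ℝ) (K : Matrix n m ℂ) :
    spectralForm hA.posSemidef.1 hW.posSemidef.1 (fun x y => x ^ p * y ^ q) K =
      (trace (Kᴴ * A ^ p * K * W ^ q)).re := by
  rw [CFC.rpow_eq_cfc_real hA, CFC.rpow_eq_cfc_real hW, ← spectralForm_mul_eq_re_trace_cfc]

theorem spectralForm_mono {F G : ℝ → ℝ → ℝ} (hA : A.PosSemidef) (hW : W.PosSemidef)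
    (hFG : ∀ x y, 0 ≤ x → 0 ≤ y → F x y ≤ G x y) (K : Matrix n m ℂ) :
    spectralForm hA.1 hW.1 F K ≤ spectralForm hA.1 hW.1 G K :=
  Finset.sum_le_sum fun i _ => Finset.sum_le_sum fun j _ =>
    mul_le_mul_of_nonneg_right (hFG _ _ (hA.eigenvalues_nonneg i) (hW.eigenvalues_nonneg j))
      (Complex.normSq_nonneg _)

theorem spectralForm_add (hA : A.IsHermitian) (hW : W.IsHermitian) (F G : ℝ → ℝ → ℝ)
    (K : Matrix n m ℂ) :
    spectralForm hA hW (fun x y => F x y + G x y) K =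
      spectralForm hA hW F K + spectralForm hA hW G K := by
  simp only [spectralForm, add_mul, Finset.sum_add_distrib]

theorem spectralForm_const_mul (hA : A.IsHermitian) (hW : W.IsHermitian) (c : ℝ)
    (F : ℝ → ℝ → ℝ) (K : Matrix n m ℂ) :
    spectralForm hA hW (fun x y => c * F x y) K = c * spectralForm hA hW F K := by
  simp only [spectralForm, Finset.mul_sum, mul_assoc]

theorem spectralForm_congr {F G : ℝ → ℝ → ℝ} (hA : A.PosSemidef) (hW : W.PosSemidef)
    (hFG : ∀ x y, 0 ≤ x → 0 ≤ y → F x y = G x y) (K : Matrix n m ℂ) :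
    spectralForm hA.1 hW.1 F K = spectralForm hA.1 hW.1 G K :=
  (spectralForm_mono hA hW (fun x y hx hy => (hFG x y hx hy).le) K).antisymm
    (spectralForm_mono hA hW (fun x y hx hy => (hFG x y hx hy).ge) K)

theorem integrable_spectralForm {α : Type*} [MeasurableSpace α] {μ : Measure α}
    {F : α → ℝ → ℝ → ℝ} (hA : A.PosSemidef) (hW : W.PosSemidef)
    (hF : ∀ x y, 0 ≤ x → 0 ≤ y → Integrable (fun t => F t x y) μ) (K : Matrix n m ℂ) :
    Integrable (fun t => spectralForm hA.1 hW.1 (F t) K) μ :=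
  integrable_finsetSum _ fun i _ => integrable_finsetSum _ fun j _ =>
    (hF _ _ (hA.eigenvalues_nonneg i) (hW.eigenvalues_nonneg j)).mul_const _

theorem integral_spectralForm {α : Type*} [MeasurableSpace α] {μ : Measure α}
    {F : α → ℝ → ℝ → ℝ} (hA : A.PosSemidef) (hW : W.PosSemidef)
    (hF : ∀ x y, 0 ≤ x → 0 ≤ y → Integrable (fun t => F t x y) μ) (K : Matrix n m ℂ) :
    ∫ t, spectralForm hA.1 hW.1 (F t) K ∂μ =
      spectralForm hA.1 hW.1 (fun x y => ∫ t, F t x y ∂μ) K := by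
  have hterm (i : n) (j : m) :=
    (hF _ _ (hA.eigenvalues_nonneg i) (hW.eigenvalues_nonneg j)).mul_const
      (Complex.normSq (toEigenbases hA.1 hW.1 K i j))
  simp only [spectralForm]
  rw [integral_finsetSum _ fun i _ => integrable_finsetSum _ fun j _ => hterm i j]
  refine Finset.sum_congr rfl fun i _ => ?_
  rw [integral_finsetSum _ fun j _ => hterm i j]
  simp only [integral_mul_const]

end SpectralForm

theorem rpow_add_of_pos [DecidableEq n] (X : Matrix n n ℂ) {p q : ℝ} (hp : 0 < p) (hq : 0 < q) :
    X ^ (p + q) = X ^ p * X ^ q := by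
  lift p to NNReal using hp.le
  lift q to NNReal using hq.le
  rw [NNReal.coe_pos] at hp hq
  rw [← NNReal.coe_add, ← CFC.nnrpow_eq_rpow (add_pos hp hq), ← CFC.nnrpow_eq_rpow hp,
    ← CFC.nnrpow_eq_rpow hq, CFC.nnrpow_add hp hq]

section TraceInequalities

theorem monotone_re_trace : Monotone fun X : Matrix n n ℂ => (trace X).re := fun _ _ hXY =>
  (Complex.le_def.1 ((tracePositiveLinearMap n ℂ ℂ).monotone' hXY)).1

theorem re_trace_mul_eq_spectralForm [DecidableEq n] {X Y : Matrix n n ℂ} (hX : X.IsHermitian)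
    (hY : Y.IsHermitian) :
    (trace (X * Y)).re = spectralForm hX hY (fun x y => x * y) 1 := by
  rw [spectralForm_mul_eq_re_trace_cfc hX hY (fun x => x) (fun y => y), cfc_id' ℝ X, cfc_id' ℝ Y,
    conjTranspose_one, Matrix.one_mul, Matrix.mul_one]

theorem re_trace_mul_nonneg {X Y : Matrix n n ℂ} (hX : 0 ≤ X) (hY : 0 ≤ Y) :
    0 ≤ (trace (X * Y)).re := by
  classical
  rw [re_trace_mul_eq_spectralForm hX.posSemidef.1 hY.posSemidef.1]
  exact Finset.sum_nonneg fun i _ => Finset.sum_nonneg fun j _ =>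
    mul_nonneg (mul_nonneg (hX.posSemidef.eigenvalues_nonneg i)
      (hY.posSemidef.eigenvalues_nonneg j)) (Complex.normSq_nonneg _)

theorem re_trace_mul_le_re_trace_mul_left {X Y Z : Matrix n n ℂ} (hXY : X ≤ Y) (hZ : 0 ≤ Z) :
    (trace (X * Z)).re ≤ (trace (Y * Z)).re := by
  have h := re_trace_mul_nonneg (sub_nonneg.2 hXY) hZ
  rwa [Matrix.sub_mul, trace_sub, Complex.sub_re, sub_nonneg] at h

variable [DecidableEq n]

theorem re_trace_mul_le_of_holderConjugate {X Y : Matrix n n ℂ} (hX : 0 ≤ X) (hY : 0 ≤ Y)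
    {p q : ℝ} (hpq : p.HolderConjugate q) :
    (trace (X * Y)).re ≤ p⁻¹ * (trace (X ^ p)).re + q⁻¹ * (trace (Y ^ q)).re := by
  have hXp : (trace (X ^ p)).re =
      spectralForm hX.posSemidef.1 hY.posSemidef.1 (fun x y => x ^ p * y ^ (0 : ℝ)) 1 := by
    rw [spectralForm_rpow_mul_rpow hX hY, CFC.rpow_zero Y hY]
    simp only [conjTranspose_one, Matrix.one_mul, Matrix.mul_one]
  have hYq : (trace (Y ^ q)).re =
      spectralForm hX.posSemidef.1 hY.posSemidef.1 (fun x y => x ^ (0 : ℝ) * y ^ q) 1 := by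
    rw [spectralForm_rpow_mul_rpow hX hY, CFC.rpow_zero X hX]
    simp only [conjTranspose_one, Matrix.one_mul]
  rw [re_trace_mul_eq_spectralForm hX.posSemidef.1 hY.posSemidef.1, hXp, hYq,
    ← spectralForm_const_mul, ← spectralForm_const_mul, ← spectralForm_add]
  refine spectralForm_mono hX.posSemidef hY.posSemidef (fun x y hx hy => ?_) 1
  simpa only [Real.rpow_zero, mul_one, one_mul, div_eq_inv_mul] using
    Real.young_inequality_of_nonneg hx hy hpq

open scoped Matrix.Norms.L2Operator in
theorem re_trace_rpow_le_re_trace_rpow {X Y : Matrix n n ℂ} (hX : 0 ≤ X) (hXY : X ≤ Y) {q : ℝ}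
    (hq : 0 ≤ q) : (trace (X ^ q)).re ≤ (trace (Y ^ q)).re := by
  rcases le_or_gt q 1 with hq1 | hq1
  · exact monotone_re_trace (CFC.rpow_le_rpow ⟨hq, hq1⟩ hXY)
  have hconj := Real.HolderConjugate.conjExponent hq1
  have hpow : X * X ^ (q - 1) = X ^ q := by
    have h := rpow_add_of_pos X one_pos (sub_pos.2 hq1)
    rwa [add_sub_cancel, CFC.rpow_one X hX, eq_comm] at h
  have hYoung : (trace (X ^ q)).re ≤
      q⁻¹ * (trace (Y ^ q)).re + (q.conjExponent)⁻¹ * (trace (X ^ q)).re := by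
    calc (trace (X ^ q)).re = (trace (X * X ^ (q - 1))).re := by rw [hpow]
      _ ≤ (trace (Y * X ^ (q - 1))).re :=
        re_trace_mul_le_re_trace_mul_left hXY CFC.rpow_nonneg
      _ ≤ _ := re_trace_mul_le_of_holderConjugate (hX.trans hXY) CFC.rpow_nonneg hconj
      _ = _ := by
        rw [CFC.rpow_rpow_of_exponent_nonneg _ _ _ (sub_pos.2 hq1).le hconj.symm.nonneg,
          hconj.sub_one_mul_conj]
  rw [← hconj.one_sub_inv, sub_mul, one_mul] at hYoung
  exact le_of_mul_le_mul_left (by linarith) hconj.inv_pos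

end TraceInequalities

section ParallelSum

theorem parallelSum_mul_normSq_le {x y t : ℝ} (hx : 0 ≤ x) (hy : 0 ≤ y) (ht : 0 < t) (k u : ℂ) :
    x * y / (x + t * y) * Complex.normSq k ≤
      x / t * Complex.normSq u + y * Complex.normSq (k - u) := by
  have hu := Complex.normSq_nonneg u
  have hku := Complex.normSq_nonneg (k - u)
  rcases (show 0 ≤ x + t * y by positivity).eq_or_lt with h | h
  · rw [← h, div_zero, zero_mul]
    positivity
  rw [div_mul_eq_mul_div, div_le_iff₀ h, ← sub_nonneg]
  calc 0 ≤ Complex.normSq (x * u - t * y * (k - u)) / t :=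
        div_nonneg (Complex.normSq_nonneg _) ht.le
    _ = _ := by
      simp only [Complex.normSq_apply, Complex.sub_re, Complex.sub_im, Complex.mul_re,
        Complex.mul_im, Complex.ofReal_re, Complex.ofReal_im]
      field_simp
      ring

theorem parallelSum_mul_normSq_eq {x y t : ℝ} (hx : 0 ≤ x) (hy : 0 ≤ y) (ht : 0 < t) (k : ℂ) :
    x / t * Complex.normSq ((t * y / (x + t * y) : ℝ) * k) +
        y * Complex.normSq (k - (t * y / (x + t * y) : ℝ) * k) =
      x * y / (x + t * y) * Complex.normSq k := by
  rcases hy.eq_or_lt with rfl | hy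
  · simp
  have h : x + t * y ≠ 0 := by positivity
  have hcompl : k - (t * y / (x + t * y) : ℝ) * k = (x / (x + t * y) : ℝ) * k := by
    rw [show x / (x + t * y) = 1 - t * y / (x + t * y) by field_simp; ring]
    push_cast
    ring
  rw [hcompl, Complex.normSq_mul, Complex.normSq_mul, Complex.normSq_ofReal, Complex.normSq_ofReal]
  field_simp
  ring

/-- The energy `t⁻¹ ⟪X, A X⟫ + ⟪K - X, (K - X) W⟫` of the splitting `K = X + (K - X)`, for the
Hilbert–Schmidt inner product. -/
noncomputable def splitEnergy (A : Matrix n n ℂ) (W : Matrix m m ℂ) (t : ℝ)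
    (K X : Matrix n m ℂ) : ℝ :=
  (trace (Xᴴ * A * X)).re / t + (trace ((K - X)ᴴ * (K - X) * W)).re

/-- The quadratic form at `K` of the parallel sum `(t L⁻¹ + R⁻¹)⁻¹`, where `L` is left
multiplication by `A` and `R` is right multiplication by `W`. The variational definition makes sense
for singular `A` and `W`. -/
noncomputable def parallelSumForm (A : Matrix n n ℂ) (W : Matrix m m ℂ) (t : ℝ)
    (K : Matrix n m ℂ) : ℝ :=
  ⨅ X, splitEnergy A W t K X

theorem splitEnergy_add_smul (A₁ A₂ : Matrix n n ℂ) (W₁ W₂ : Matrix m m ℂ) (a b t : ℝ)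
    (K X : Matrix n m ℂ) :
    splitEnergy (a • A₁ + b • A₂) (a • W₁ + b • W₂) t K X =
      a * splitEnergy A₁ W₁ t K X + b * splitEnergy A₂ W₂ t K X := by
  simp only [splitEnergy, Matrix.mul_add, Matrix.add_mul, Matrix.mul_smul, Matrix.smul_mul,
    trace_add, trace_smul, Complex.add_re, Complex.smul_re, smul_eq_mul]
  ring

variable [DecidableEq m] [DecidableEq n] {A : Matrix n n ℂ} {W : Matrix m m ℂ} {t : ℝ}

theorem splitEnergy_eq_sum (hA : A.IsHermitian) (hW : W.IsHermitian) (t : ℝ) (K X : Matrix n m ℂ) :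
    splitEnergy A W t K X = ∑ i, ∑ j,
      (hA.eigenvalues i / t * Complex.normSq (toEigenbases hA hW X i j) +
        hW.eigenvalues j *
          Complex.normSq (toEigenbases hA hW K i j - toEigenbases hA hW X i j)) := by
  have hleft := spectralForm_mul_eq_re_trace_cfc hA hW (fun x => x) (fun _ => 1) X
  have hright := spectralForm_mul_eq_re_trace_cfc hA hW (fun _ => 1) (fun y => y) (K - X)
  rw [cfc_id' ℝ A, cfc_const_one ℝ W, Matrix.mul_one] at hleft
  rw [cfc_id' ℝ W, cfc_const_one ℝ A, Matrix.mul_one] at hright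
  rw [splitEnergy, ← hleft, ← hright]
  simp only [spectralForm, mul_one, one_mul, map_sub, Matrix.sub_apply, Finset.sum_div,
    Finset.sum_add_distrib, div_mul_eq_mul_div]

theorem isLeast_splitEnergy (hA : A.PosSemidef) (hW : W.PosSemidef) (ht : 0 < t)
    (K : Matrix n m ℂ) :
    IsLeast (range (splitEnergy A W t K))
      (spectralForm hA.1 hW.1 (fun x y => x * y / (x + t * y)) K) := by
  constructor
  · let x := hA.1.eigenvalues
    let y := hW.1.eigenvalues
    refine ⟨(toEigenbases hA.1 hW.1).symm (of fun i j =>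
      ((t * y j / (x i + t * y j) : ℝ) : ℂ) * toEigenbases hA.1 hW.1 K i j), ?_⟩
    rw [splitEnergy_eq_sum hA.1 hW.1, LinearEquiv.apply_symm_apply]
    exact Finset.sum_congr rfl fun i _ => Finset.sum_congr rfl fun j _ =>
      parallelSum_mul_normSq_eq (hA.eigenvalues_nonneg i) (hW.eigenvalues_nonneg j) ht _
  · rintro _ ⟨X, rfl⟩
    rw [splitEnergy_eq_sum hA.1 hW.1]
    exact Finset.sum_le_sum fun i _ => Finset.sum_le_sum fun j _ =>
      parallelSum_mul_normSq_le (hA.eigenvalues_nonneg i) (hW.eigenvalues_nonneg j) ht _ _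

theorem parallelSumForm_eq_spectralForm (hA : A.PosSemidef) (hW : W.PosSemidef) (ht : 0 < t)
    (K : Matrix n m ℂ) :
    parallelSumForm A W t K = spectralForm hA.1 hW.1 (fun x y => x * y / (x + t * y)) K :=
  (isLeast_splitEnergy hA hW ht K).csInf_eq

end ParallelSum

section Lieb

theorem concaveOn_parallelSumForm {t : ℝ} (ht : 0 < t) (K : Matrix n m ℂ) :
    ConcaveOn ℝ (Ici (0 : Matrix n n ℂ) ×ˢ Ici (0 : Matrix m m ℂ))
      (fun P => parallelSumForm P.1 P.2 t K) := by
  classical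
  refine ⟨(convex_Ici 0).prod (convex_Ici 0), ?_⟩
  rintro ⟨A₁, W₁⟩ ⟨hA₁, hW₁⟩ ⟨A₂, W₂⟩ ⟨hA₂, hW₂⟩ a b ha hb -
  have hle {A : Matrix n n ℂ} {W : Matrix m m ℂ} (hA : 0 ≤ A) (hW : 0 ≤ W) (X : Matrix n m ℂ) :
      parallelSumForm A W t K ≤ splitEnergy A W t K X :=
    ciInf_le ⟨_, (isLeast_splitEnergy hA.posSemidef hW.posSemidef ht K).2⟩ X
  refine le_ciInf fun X => ?_
  rw [Prod.fst_add, Prod.snd_add, Prod.smul_fst, Prod.smul_snd, Prod.smul_fst, Prod.smul_snd,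
    splitEnergy_add_smul]
  exact add_le_add (mul_le_mul_of_nonneg_left (hle hA₁ hW₁ X) ha)
    (mul_le_mul_of_nonneg_left (hle hA₂ hW₂ X) hb)

open Real (rpowIntegrand₀₁ rpowIntegrand₀₁_eq_pow_div)

theorem exists_measure_rpow_mul_rpow_one_sub_eq_integral {s : ℝ} (hs : s ∈ Ioo 0 1) :
    ∃ μ : Measure ℝ, ∀ x y, 0 ≤ x → 0 ≤ y →
      IntegrableOn (fun t => t ^ (s - 1) * (x * y / (x + t * y))) (Ioi 0) μ ∧
      ∫ t in Ioi 0, t ^ (s - 1) * (x * y / (x + t * y)) ∂μ = x ^ s * y ^ (1 - s) := by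
  obtain ⟨μ, hμ⟩ := Real.exists_measure_rpow_eq_integral_rpowIntegrand₀₁ hs
  refine ⟨μ, fun x y hx hy => ?_⟩
  obtain ⟨hint, heq⟩ := hμ (x / y) (div_nonneg hx hy)
  have hscale : EqOn (fun t => y * rpowIntegrand₀₁ s t (x / y))
      (fun t => t ^ (s - 1) * (x * y / (x + t * y))) (Ioi 0) := by
    intro t (ht : 0 < t)
    simp only [rpowIntegrand₀₁_eq_pow_div hs ht.le (div_nonneg hx hy)]
    rcases hy.eq_or_lt with rfl | hy
    · simp
    · have : x + t * y ≠ 0 := by positivity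
      have : t + x / y ≠ 0 := by positivity
      field_simp
      ring
  refine ⟨IntegrableOn.congr_fun (hint.const_mul y) hscale measurableSet_Ioi, ?_⟩
  rw [← setIntegral_congr_fun measurableSet_Ioi hscale, integral_const_mul, ← heq]
  rcases hy.eq_or_lt with rfl | hy
  · rw [zero_mul, Real.zero_rpow (sub_pos.2 hs.2).ne', mul_zero]
  · rw [Real.div_rpow hx hy.le, Real.rpow_sub hy, Real.rpow_one]
    ring

variable [DecidableEq m] [DecidableEq n]

theorem exists_measure_re_trace_rpow_mul_rpow_eq_integral {s : ℝ} (hs : s ∈ Ioo 0 1)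
    (K : Matrix n m ℂ) :
    ∃ μ : Measure ℝ, ∀ (A : Matrix n n ℂ) (W : Matrix m m ℂ), 0 ≤ A → 0 ≤ W →
      IntegrableOn (fun t => t ^ (s - 1) * parallelSumForm A W t K) (Ioi 0) μ ∧
      ∫ t in Ioi 0, t ^ (s - 1) * parallelSumForm A W t K ∂μ =
        (trace (Kᴴ * A ^ s * K * W ^ (1 - s))).re := by
  obtain ⟨μ, hμ⟩ := exists_measure_rpow_mul_rpow_one_sub_eq_integral hs
  refine ⟨μ, fun A W hA hW => ?_⟩
  have hform : EqOn
      (fun t => spectralForm hA.posSemidef.1 hW.posSemidef.1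
        (fun x y => t ^ (s - 1) * (x * y / (x + t * y))) K)
      (fun t => t ^ (s - 1) * parallelSumForm A W t K) (Ioi 0) := fun t ht => by
    simp only [parallelSumForm_eq_spectralForm hA.posSemidef hW.posSemidef ht,
      spectralForm_const_mul]
  have hint x y (hx : 0 ≤ x) (hy : 0 ≤ y) := (hμ x y hx hy).1
  refine ⟨IntegrableOn.congr_fun (integrable_spectralForm hA.posSemidef hW.posSemidef hint K) hform
    measurableSet_Ioi, ?_⟩
  rw [← setIntegral_congr_fun measurableSet_Ioi hform,
    integral_spectralForm hA.posSemidef hW.posSemidef hint, ← spectralForm_rpow_mul_rpow hA hW]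
  exact spectralForm_congr hA.posSemidef hW.posSemidef (fun x y hx hy => (hμ x y hx hy).2) K

theorem lieb_concavity {s : ℝ} (hs : s ∈ Ioo 0 1) (K : Matrix n m ℂ) :
    ConcaveOn ℝ (Ici (0 : Matrix n n ℂ) ×ˢ Ici (0 : Matrix m m ℂ))
      (fun P => (trace (Kᴴ * P.1 ^ s * K * P.2 ^ (1 - s))).re) := by
  obtain ⟨μ, hμ⟩ := exists_measure_re_trace_rpow_mul_rpow_eq_integral hs K
  refine ConcaveOn.congr ?_ fun P hP => (hμ P.1 P.2 hP.1 hP.2).2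
  refine integral_concaveOn_of_integrand_ae ((convex_Ici 0).prod (convex_Ici 0)) ?_
    fun P hP => (hμ P.1 P.2 hP.1 hP.2).1
  filter_upwards [ae_restrict_mem measurableSet_Ioi] with t ht
  exact (concaveOn_parallelSumForm ht K).smul (Real.rpow_nonneg (le_of_lt ht) (s - 1))

end Lieb

section Conjugation

variable {k : Type*} [Finite k]

theorem conjTranspose_mul_mul_nonneg {A : Matrix n n ℂ} (hA : 0 ≤ A) (B : Matrix n k ℂ) :
    0 ≤ Bᴴ * A * B :=
  (hA.posSemidef.conjTranspose_mul_mul_same B).nonneg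

theorem monotone_conjTranspose_mul_mul (B : Matrix n k ℂ) :
    Monotone fun A : Matrix n n ℂ => Bᴴ * A * B := fun A A' hAA' => by
  have h := conjTranspose_mul_mul_nonneg (sub_nonneg.2 hAA') B
  rwa [Matrix.mul_sub, Matrix.sub_mul, sub_nonneg] at h

variable [DecidableEq n]

theorem conjTranspose_mul_rpow_mul_nonneg (A : Matrix n n ℂ) (s : ℝ) (B : Matrix n k ℂ) :
    0 ≤ Bᴴ * A ^ s * B :=
  conjTranspose_mul_mul_nonneg (A := A ^ s) CFC.rpow_nonneg B

open scoped Matrix.Norms.L2Operator in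
theorem concaveOn_conjTranspose_mul_rpow_mul {s : ℝ} (hs : s ∈ Icc 0 1) (B : Matrix n k ℂ) :
    ConcaveOn ℝ (Ici (0 : Matrix n n ℂ)) (fun A => Bᴴ * A ^ s * B) := by
  refine ⟨convex_Ici 0, fun A₁ hA₁ A₂ hA₂ a b ha hb hab => ?_⟩
  have h := monotone_conjTranspose_mul_mul B ((CFC.concaveOn_rpow hs).2 hA₁ hA₂ ha hb hab)
  simpa only [Matrix.mul_add, Matrix.add_mul, Matrix.mul_smul, Matrix.smul_mul] using h

end Conjugation

section Concavity

theorem concaveOn_comp_of_mapsTo {𝕜 E F β : Type*} [Semiring 𝕜] [PartialOrder 𝕜]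
    [AddCommMonoid E] [AddCommMonoid F] [PartialOrder F] [AddCommMonoid β] [PartialOrder β]
    [SMul 𝕜 E] [SMul 𝕜 F] [SMul 𝕜 β] {f : E → F} {g : F → β} {s : Set E} {t : Set F}
    (hg : ConcaveOn 𝕜 t g) (hg_mono : MonotoneOn g t) (hf : ConcaveOn 𝕜 s f) (hst : MapsTo f s t) :
    ConcaveOn 𝕜 s (g ∘ f) :=
  ⟨hf.1, fun _ hx _ hy _ _ ha hb hab =>
    (hg.2 (hst hx) (hst hy) ha hb hab).trans
      (hg_mono (hg.1 (hst hx) (hst hy) ha hb hab) (hst (hf.1 hx hy ha hb hab))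
        (hf.2 hx hy ha hb hab))⟩

theorem concaveOn_re_trace : ConcaveOn ℝ univ fun X : Matrix n n ℂ => (trace X).re :=
  (Complex.reLm.comp (traceLinearMap n ℝ ℂ)).concaveOn convex_univ

variable [DecidableEq n]

theorem re_trace_mul_rpow_one_sub_le {s : ℝ} (hs : s ∈ Ioo 0 1) {X W : Matrix n n ℂ}
    (hX : 0 ≤ X) (hW : 0 ≤ W) :
    (trace (X * W ^ (1 - s))).re ≤
      s * (trace (X ^ s⁻¹)).re + (1 - s) * (trace W).re := by
  have h := re_trace_mul_le_of_holderConjugate hX (CFC.rpow_nonneg (a := W) (y := 1 - s))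
    (Real.HolderConjugate.inv_one_sub_inv hs.1 hs.2)
  rwa [CFC.rpow_rpow_of_exponent_nonneg _ _ _ (sub_pos.2 hs.2).le
    (inv_pos.2 (sub_pos.2 hs.2)).le, mul_inv_cancel₀ (sub_pos.2 hs.2).ne', CFC.rpow_one W hW,
    inv_inv, inv_inv] at h

theorem mul_rpow_inv_rpow_one_sub {s : ℝ} (hs : s ∈ Ioo 0 1) {X : Matrix n n ℂ} (hX : 0 ≤ X) :
    X * (X ^ s⁻¹) ^ (1 - s) = X ^ s⁻¹ := by
  have hpos : 0 < s⁻¹ * (1 - s) := mul_pos (inv_pos.2 hs.1) (sub_pos.2 hs.2)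
  have hsum : 1 + s⁻¹ * (1 - s) = s⁻¹ := by
    rw [mul_sub, mul_one, inv_mul_cancel₀ hs.1.ne', add_sub_cancel]
  have hadd := rpow_add_of_pos X one_pos hpos
  rw [CFC.rpow_rpow_of_exponent_nonneg _ _ _ (inv_pos.2 hs.1).le (sub_pos.2 hs.2).le]
  rw [hsum, CFC.rpow_one X hX] at hadd
  exact hadd.symm

variable [DecidableEq m]

theorem concaveOn_re_trace_conj_rpow_inv {s : ℝ} (hs : s ∈ Ioo 0 1) (B : Matrix n m ℂ) :
    ConcaveOn ℝ (Ici (0 : Matrix n n ℂ))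
      (fun A => (trace ((Bᴴ * A ^ s * B) ^ s⁻¹)).re) := by
  refine ⟨convex_Ici 0, fun A₁ hA₁ A₂ hA₂ a b ha hb hab => ?_⟩
  have hW (A : Matrix n n ℂ) : 0 ≤ (Bᴴ * A ^ s * B) ^ s⁻¹ := CFC.rpow_nonneg
  have hlieb := (lieb_concavity hs B).2 (mk_mem_prod hA₁ (hW A₁)) (mk_mem_prod hA₂ (hW A₂))
    ha hb hab
  have hvar := re_trace_mul_rpow_one_sub_le hs
    (conjTranspose_mul_rpow_mul_nonneg (a • A₁ + b • A₂) s B)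
    (convex_Ici (0 : Matrix m m ℂ) (hW A₁) (hW A₂) ha hb hab)
  simp only [Prod.smul_mk, Prod.mk_add_mk, smul_eq_mul,
    mul_rpow_inv_rpow_one_sub hs (conjTranspose_mul_rpow_mul_nonneg _ s B)] at hlieb
  simp only [trace_add, trace_smul, Complex.add_re, Complex.smul_re, smul_eq_mul] at hvar
  exact le_of_mul_le_mul_left (by simp only [smul_eq_mul]; linarith) hs.1

open scoped Matrix.Norms.L2Operator in
theorem concaveOn_re_trace_conj_rpow_of_le {s r : ℝ} (hs0 : 0 < s) (hs1 : s ≤ 1) (hr0 : 0 ≤ r)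
    (hrs : r ≤ s) (B : Matrix n m ℂ) :
    ConcaveOn ℝ (Ici (0 : Matrix n n ℂ))
      (fun A => (trace ((Bᴴ * A ^ s * B) ^ (r / s))).re) := by
  have hq : r / s ∈ Icc 0 1 := ⟨div_nonneg hr0 hs0.le, div_le_one_of_le₀ hrs hs0.le⟩
  have htrace : ConcaveOn ℝ (Ici 0) fun X : Matrix m m ℂ => (trace (X ^ (r / s))).re :=
    concaveOn_comp_of_mapsTo (g := fun X : Matrix m m ℂ => (trace X).re) concaveOn_re_trace
      (monotone_re_trace.monotoneOn _) (CFC.concaveOn_rpow hq) (mapsTo_univ _ _)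
  have hmono : MonotoneOn (fun X : Matrix m m ℂ => (trace (X ^ (r / s))).re) (Ici 0) :=
    fun X hX Y _ hXY => re_trace_rpow_le_re_trace_rpow hX hXY hq.1
  exact concaveOn_comp_of_mapsTo (g := fun X : Matrix m m ℂ => (trace (X ^ (r / s))).re) htrace
    hmono (concaveOn_conjTranspose_mul_rpow_mul ⟨hs0.le, hs1⟩ B)
    fun A _ => conjTranspose_mul_rpow_mul_nonneg A s B

open scoped Matrix.Norms.L2Operator in
theorem concaveOn_re_trace_conj_rpow_of_lt {s r : ℝ} (hs0 : 0 < s) (hsr : s < r) (hr1 : r ≤ 1)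
    (B : Matrix n m ℂ) :
    ConcaveOn ℝ (Ici (0 : Matrix n n ℂ))
      (fun A => (trace ((Bᴴ * A ^ s * B) ^ (r / s))).re) := by
  have hr0 : 0 < r := hs0.trans hsr
  have hq : s / r ∈ Ioo 0 1 := ⟨div_pos hs0 hr0, (div_lt_one hr0).2 hsr⟩
  have hmono : MonotoneOn (fun Z : Matrix n n ℂ => (trace ((Bᴴ * Z ^ (s / r) * B) ^ (r / s))).re)
      (Ici 0) := fun Z _ Z' _ hZZ' =>
    re_trace_rpow_le_re_trace_rpow (conjTranspose_mul_rpow_mul_nonneg Z (s / r) B)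
      (monotone_conjTranspose_mul_mul B (CFC.rpow_le_rpow (Ioo_subset_Icc_self hq) hZZ'))
      (div_nonneg hr0.le hs0.le)
  have hconcave := concaveOn_re_trace_conj_rpow_inv hq B
  rw [inv_div] at hconcave
  refine (concaveOn_comp_of_mapsTo hconcave hmono (CFC.concaveOn_rpow ⟨hr0.le, hr1⟩)
    fun A _ => CFC.rpow_nonneg (a := A)).congr fun A hA => ?_
  simp only [Function.comp_apply]
  rw [CFC.rpow_rpow_of_exponent_nonneg A _ _ hr0.le hq.1.le, mul_div_cancel₀ s hr0.ne']

end Concavity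

theorem corollary3p4_general [DecidableEq m] [DecidableEq n] (B : Matrix n m ℂ) {s r : ℝ}
    (hs0 : 0 < s) (hs1 : s ≤ 1) (hr0 : 0 < r) (hr1 : r ≤ 1) :
    ConcaveOn ℝ {A : Matrix n n ℂ | A.PosSemidef}
      (fun A => (trace ((Bᴴ * A ^ s * B) ^ (r / s))).re) := by
  have hcone : {A : Matrix n n ℂ | A.PosSemidef} = Ici 0 :=
    ext fun A => nonneg_iff_posSemidef.symm
  rw [hcone]
  rcases le_or_gt r s with hrs | hsr
  · exact concaveOn_re_trace_conj_rpow_of_le hs0 hs1 hr0.le hrs B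
  · exact concaveOn_re_trace_conj_rpow_of_lt hs0 hsr hr1 B

theorem corollary3p4 (m : ℕ) (B : Matrix (Fin m) (Fin m) ℂ) (s r : ℝ)
    (hs0 : 0 < s) (hs1 : s < 1) (hr0 : 0 < r) (hr1 : r ≤ 1) :
    ConcaveOn ℝ {A : Matrix (Fin m) (Fin m) ℂ | A.PosSemidef}
      (fun A : Matrix (Fin m) (Fin m) ℂ =>
        (Matrix.trace ((Bᴴ * A ^ s * B) ^ (r / s))).re) :=
  corollary3p4_general B hs0 hs1.le hr0 hr1
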